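/- Let $1<p<\infty$, $0<\alpha<1/p$, $q=\dfrac{p}{1-\alpha p}$, and let $\theta_1,\theta_2>0$. For $1<r<\infty$ and $\theta>0$ let $L^{r),\theta}([0,1])$ be the space of measurable functions $f:[0,1]\to\mathbb R$ with $$\|f\|_{L^{r),\theta}}=\sup_{0<\varepsilon<r-1}\Big(\varepsilon^{\theta}\int_0^1|f(t)|^{r-\varepsilon}\,dt\Big)^{1/(r-\varepsilon)}<\infty .$$ Let $T_\alpha$ be any one of the operators $$I_\alpha f(x)=\int_0^1\frac{f(t)}{|x-t|^{1-\alpha}}\,dt,\qquad R_\alpha f(x)=\int_0^x\frac{f(t)}{(x-t)^{1-\alpha}}\,dt,\qquad W_\alpha f(x)=\int_x^1\frac{f(t)}{(t-x)^{1-\alpha}}\,dt,\qquad x\in(0,1).$$ For every $f\in L^{p),\theta_1}([0,1])$ the integral defining $T_\alpha f(x)$ converges absolutely for almost every $x$. Moreover, where $T_\alpha$ is called bounded from $L^{p),\theta_1}$ to $L^{q),\theta_2}$ if it maps $L^{p),\theta_1}([0,1])$ into $L^{q),\theta_2}([0,1])$ and there is a constant $C$ with $\|T_\alpha f\|_{L^{q),\theta_2}}\le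 C\|f\|_{L^{p),\theta_1}}$ for all $f\in L^{p),\theta_1}([0,1])$: (i) if $\theta_2<(1+\alpha q)\theta_1$, then $T_\alpha$ is not bounded from $L^{p),\theta_1}$ to $L^{q),\theta_2}$; (ii) if $\theta_2\ge(1+\alpha q)\theta_1$, then $T_\alpha$ is bounded from $L^{p),\theta_1}$ to $L^{q),\theta_2}$. -/

import Mathlib

open MeasureTheory Set
open scoped ENNReal NNReal

noncomputable section

/-- The norm of the grand Lebesgue space `L^{p),θ}(Ω)` for `Ω ⊆ ℝ`,
`sup_{0 < ε < p - 1} ( (ε ^ θ / |Ω|) ∫_Ω |f| ^ (p - ε) ) ^ (1 / (p - ε))`,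
as an element of `[0, ∞]`. -/
def grandNorm (Ω : Set ℝ) (p θ : ℝ) (f : ℝ → ℝ) : ℝ≥0∞ :=
  ⨆ ε ∈ Ioo (0 : ℝ) (p - 1),
    (ENNReal.ofReal (ε ^ θ) / volume Ω * ∫⁻ t in Ω, ‖f t‖ₑ ^ (p - ε)) ^ (1 / (p - ε))

/-- Membership in `L^{p),θ}(Ω)`: `f` is (a.e. equal on `Ω` to) a measurable function, and its norm
is finite. Functions on `Ω` are represented by functions on `ℝ`; values off `Ω` play no role. -/
def MemGrandLp (Ω : Set ℝ) (p θ : ℝ) (f : ℝ → ℝ) : Prop :=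
  AEStronglyMeasurable f (volume.restrict Ω) ∧ grandNorm Ω p θ f < ∞

/-- The three potential operators: the Riesz potential `I_α` and the one-sided potentials
`R_α` (left) and `W_α` (right). -/
inductive PotentialKind where
  | I
  | R
  | W

namespace PotentialKind

/-- The set over which the integral defining the potential at the point `x` is taken. -/
def domain (T : PotentialKind) (x : ℝ) : Set ℝ :=
  match T with
  | I => Ioo 0 1
  | R => Ioo 0 x
  | W => Ioo x 1

/-- The integrand, as a function of `t`, of the integral defining the potential of `f` at `x`. -/
def integrand (T : PotentialKind) (α : ℝ) (f : ℝ → ℝ) (x t : ℝ) : ℝ :=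
  match T with
  | I => f t / |x - t| ^ (1 - α)
  | R => f t / (x - t) ^ (1 - α)
  | W => f t / (t - x) ^ (1 - α)

/-- The potential operator on `[0, 1]`: for `x ∈ [0, 1]`,
`I_α f (x) = ∫_0^1 f(t) / |x - t|^{1-α} dt`,
`R_α f (x) = ∫_0^x f(t) / (x - t)^{1-α} dt`,
`W_α f (x) = ∫_x^1 f(t) / (t - x)^{1-α} dt`. -/
def op (T : PotentialKind) (α : ℝ) (f : ℝ → ℝ) (x : ℝ) : ℝ :=
  ∫ t in T.domain x, T.integrand α f x t

end PotentialKind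

/-- The operator `A` is bounded from `L^{p),θ₁}([0,1])` to `L^{q),θ₂}([0,1])`. -/
def BoundedGrandLp (A : (ℝ → ℝ) → (ℝ → ℝ)) (p θ₁ q θ₂ : ℝ) : Prop :=
  ∃ C : ℝ≥0, ∀ f : ℝ → ℝ, MemGrandLp (Icc 0 1) p θ₁ f →
    MemGrandLp (Icc 0 1) q θ₂ (A f) ∧
      grandNorm (Icc 0 1) q θ₂ (A f) ≤ C * grandNorm (Icc 0 1) p θ₁ f

end

/-!
Write `q = p / (1 - α p)`, so that `1 + α q = q / p = 1 / (1 - α p)`, and the critical value of `θ₂`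
is `θ₁ / (1 - α p)`.

*Boundedness.* All three potentials are dominated by the Riesz potential `J` on the line of `|f|`
cut off to `[0, 1]`, so it suffices to have the Hardy-Littlewood-Sobolev inequality
`‖J F‖_s ≤ A ‖F‖_r`, `s = r / (1 - α r)`, with `A` uniform for `r` in a compact subinterval of
`(1, 1 / α)` (`rieszLIntegral_Lp_le`, `PotentialKind.exists_eLpNorm'_op_le`). It is proved without a
maximal function. For `‖F‖_r = 1` and a height `γ > 0`, cut the kernel at `δ = γ ^ (-r)`: the far
part of the kernel (by Hölder) and the near part applied to `F` below height `γ` contribute at most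
`K γ ^ (1 - α r)` (`rieszLIntegral_le`), and Markov's inequality for what remains gives
`|{J F > 2 K γ ^ (1 - α r)}| ≤ γ⁻¹ ∫_{F > γ} F`. This is a weak type `(1, 1)` bound for a power of
`J F`, and integration over `γ` turns it into the strong inequality
(`lintegral_rpow_le_of_meas_lt_le`). If `η = p - r` and `ε = q - s`, then `ε ≤ η / (1 - α p) ^ 2`,
and `θ₂ ≥ θ₁ / (1 - α p)` makes `θ₂ / s ≥ θ₁ / r`; hence the weight `ε ^ (θ₂ / s)` is at
most a multiple of `η ^ (θ₁ / r)` (`exists_rpow_gap_le`). Exponents `s` away from `q` are handled by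
Hölder's inequality on `[0, 1]`. The same inequality shows that `J F` is finite almost everywhere,
which is the absolute convergence.

*Unboundedness.* For `a = exp (-L)` the norm of the indicator function of `(0, a)` in `L^{p),θ₁}` is
`O (L ^ (-θ₁ / p) a ^ (1 / p))` (`grandNorm_indicator_Ioo_le`). Its potential is at least
`a ^ α / 2` on a half of `(0, a)`, so, on testing with `ε = 1 / L`, its norm in `L^{q),θ₂}` is at
least a multiple of `L ^ (-θ₂ / q) a ^ (α + 1 / q)`, where `α + 1 / q = 1 / p`. The ratio is at least
a multiple of `L ^ (θ₁ / p - θ₂ / q)`, which is unbounded if `θ₂ < (q / p) θ₁`.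
-/

/-! ### Power integrals and the layer cake formula -/

theorem lintegral_Ioo_rpow_sub_one {b : ℝ} (hb : 0 < b) {δ : ℝ} (hδ : 0 ≤ δ) :
    ∫⁻ t in Ioo 0 δ, ENNReal.ofReal (t ^ (b - 1)) = ENNReal.ofReal (δ ^ b / b) := by
  have hint : IntegrableOn (fun t : ℝ => t ^ (b - 1)) (Ioo 0 δ) := by
    rcases hδ.eq_or_lt with rfl | hδ
    · simp
    · exact (intervalIntegral.integrableOn_Ioo_rpow_iff hδ).2 (by linarith)
  rw [← ofReal_integral_eq_lintegral_ofReal hint]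
  · rw [← integral_Ioc_eq_integral_Ioo, ← intervalIntegral.integral_of_le hδ,
      integral_rpow (Or.inl (by linarith))]
    simp [Real.zero_rpow hb.ne']
  · filter_upwards [ae_restrict_mem measurableSet_Ioo] with t ht
    exact Real.rpow_nonneg ht.1.le _

theorem lintegral_Ioi_rpow_of_lt {c : ℝ} (hc : c < -1) {δ : ℝ} (hδ : 0 < δ) :
    ∫⁻ t in Ioi δ, ENNReal.ofReal (t ^ c) = ENNReal.ofReal (δ ^ (c + 1) / (-(c + 1))) := by
  rw [← ofReal_integral_eq_lintegral_ofReal (integrableOn_Ioi_rpow_of_lt hc hδ)]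
  · rw [integral_Ioi_rpow_of_lt hc hδ, neg_div, div_neg]
  · filter_upwards [ae_restrict_mem measurableSet_Ioi] with t ht
    exact Real.rpow_nonneg (hδ.le.trans (le_of_lt ht)) _

theorem lintegral_comp_abs_sub (g : ℝ → ℝ≥0∞) (x : ℝ) :
    ∫⁻ t, g |x - t| = 2 * ∫⁻ u in Ioi 0, g u := by
  rw [lintegral_sub_left_eq_self (fun u => g |u|) x,
    ← lintegral_add_compl (fun u => g |u|) (measurableSet_Ioi (a := (0 : ℝ))), two_mul]
  have h1 : ∫⁻ u in Ioi (0 : ℝ), g |u| = ∫⁻ u in Ioi 0, g u :=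
    setLIntegral_congr_fun measurableSet_Ioi fun u hu => by rw [abs_of_pos hu]
  congr 1
  rw [compl_Ioi, ← setLIntegral_congr Iio_ae_eq_Iic, ← h1]
  have := (Measure.measurePreserving_neg (volume : Measure ℝ)).setLIntegral_comp_preimage_emb
    (Homeomorph.neg ℝ).measurableEmbedding (fun u => g |u|) (Ioi 0)
  simpa using this

/-- The layer cake formula for a single extended nonnegative number. -/
theorem lintegral_Ioi_ite_rpow_sub_one {b : ℝ} (hb : 0 < b) (a : ℝ≥0∞) :
    ∫⁻ γ in Ioi (0 : ℝ), (if ENNReal.ofReal γ < a then ENNReal.ofReal (γ ^ (b - 1)) else 0) =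
      a ^ b / ENNReal.ofReal b := by
  have key : ∀ c : ℝ, 0 ≤ c → ∫⁻ γ in Ioi (0 : ℝ),
      (if ENNReal.ofReal γ < ENNReal.ofReal c then ENNReal.ofReal (γ ^ (b - 1)) else 0) =
      ENNReal.ofReal c ^ b / ENNReal.ofReal b := by
    intro c hc
    rw [ENNReal.ofReal_rpow_of_nonneg hc hb.le, ← ENNReal.ofReal_div_of_pos hb,
      ← lintegral_Ioo_rpow_sub_one hb hc, ← Ioi_inter_Iio, inter_comm,
      ← setLIntegral_indicator measurableSet_Iio]
    refine setLIntegral_congr_fun measurableSet_Ioi fun γ hγ => ?_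
    simp only [indicator, mem_Iio, ENNReal.ofReal_lt_ofReal_iff_of_nonneg (le_of_lt hγ)]
  -- a finite `a` is covered by `key`; for `a = ⊤` both sides are infinite, by comparison with `a = n`
  induction a with
  | coe a => simpa using key a a.2
  | top =>
    rw [ENNReal.top_rpow_of_pos hb, ENNReal.top_div_of_ne_top ENNReal.ofReal_ne_top]
    refine eq_top_iff.2 (le_of_tendsto' (x := Filter.atTop)
      (f := fun n : ℕ => ENNReal.ofReal n ^ b / ENNReal.ofReal b) ?_ fun n => ?_)
    · have h1 : Filter.Tendsto (fun n : ℕ => ENNReal.ofReal (n : ℝ) ^ b) Filter.atTop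
          (nhds ⊤) := by
        simp only [ENNReal.ofReal_natCast]
        have := (ENNReal.continuous_rpow_const (y := b)).tendsto ⊤
        rw [ENNReal.top_rpow_of_pos hb] at this
        exact this.comp ENNReal.tendsto_nat_nhds_top
      have := ENNReal.Tendsto.div_const (b := ENNReal.ofReal b) h1 (Or.inl (by simp))
      rwa [ENNReal.top_div_of_ne_top ENNReal.ofReal_ne_top] at this
    · rw [← key n n.cast_nonneg]
      refine lintegral_mono fun γ => ?_
      simp only [ENNReal.ofReal_lt_top, if_true]
      split_ifs <;> simp

/-- The diagonal step of Marcinkiewicz interpolation: a bound of weak type `(1, 1)` for `u` against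
the upper truncations of `F` gives a strong bound in `L^r`. -/
theorem lintegral_rpow_le_of_meas_lt_le {u F : ℝ → ℝ≥0∞} (hu : Measurable u) (hF : Measurable F)
    {r : ℝ} (hr : 1 < r)
    (h : ∀ γ : ℝ, 0 < γ → volume {x | ENNReal.ofReal γ < u x} ≤
      ENNReal.ofReal γ⁻¹ * ∫⁻ t, if ENNReal.ofReal γ < F t then F t else 0) :
    ∫⁻ x, u x ^ r ≤ ENNReal.ofReal (r / (r - 1)) * ∫⁻ x, F x ^ r := by
  have hr0 : 0 < r := by linarith
  have hr1 : 0 < r - 1 := by linarith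
  have hmeas : ∀ {v : ℝ → ℝ≥0∞}, Measurable v →
      MeasurableSet {z : ℝ × ℝ | ENNReal.ofReal z.2 < v z.1} := fun hv =>
    measurableSet_lt (ENNReal.measurable_ofReal.comp measurable_snd) (hv.comp measurable_fst)
  have hmeas' : ∀ {v : ℝ → ℝ≥0∞}, Measurable v →
      MeasurableSet {z : ℝ × ℝ | ENNReal.ofReal z.1 < v z.2} := fun hv =>
    measurableSet_lt (ENNReal.measurable_ofReal.comp measurable_fst) (hv.comp measurable_snd)
  have hpow : ∀ c : ℝ, Measurable fun γ : ℝ => ENNReal.ofReal (γ ^ c) := fun c =>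
    ENNReal.measurable_ofReal.comp (measurable_id.pow_const c)
  have h1 : ∫⁻ x, u x ^ r / ENNReal.ofReal r =
      ∫⁻ γ in Ioi (0 : ℝ), ENNReal.ofReal (γ ^ (r - 1)) * volume {x | ENNReal.ofReal γ < u x} := by
    simp_rw [← lintegral_Ioi_ite_rpow_sub_one hr0]
    rw [lintegral_lintegral_swap]
    · refine lintegral_congr fun γ => ?_
      rw [← lintegral_indicator_const (measurableSet_lt measurable_const hu)]
      simp only [indicator, mem_ofPred_eq]
    · exact (Measurable.ite (hmeas hu) ((hpow _).comp measurable_snd) measurable_const).aemeasurable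
  have h2 : ∫⁻ γ in Ioi (0 : ℝ), ENNReal.ofReal (γ ^ (r - 1 - 1)) *
      (∫⁻ t, if ENNReal.ofReal γ < F t then F t else 0) =
      ∫⁻ t, F t * (F t ^ (r - 1) / ENNReal.ofReal (r - 1)) := by
    simp_rw [← lintegral_Ioi_ite_rpow_sub_one hr1]
    have : ∀ t, F t * (∫⁻ γ in Ioi (0 : ℝ),
        if ENNReal.ofReal γ < F t then ENNReal.ofReal (γ ^ (r - 1 - 1)) else 0) =
        ∫⁻ γ in Ioi (0 : ℝ),
        F t * (if ENNReal.ofReal γ < F t then ENNReal.ofReal (γ ^ (r - 1 - 1)) else 0) := by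
      intro t
      rw [lintegral_const_mul]
      exact Measurable.ite (measurableSet_lt ENNReal.measurable_ofReal measurable_const)
        (hpow _) measurable_const
    simp_rw [this]
    have h3 : ∀ γ : ℝ, ENNReal.ofReal (γ ^ (r - 1 - 1)) *
        (∫⁻ t, if ENNReal.ofReal γ < F t then F t else 0) =
        ∫⁻ t, F t * (if ENNReal.ofReal γ < F t then ENNReal.ofReal (γ ^ (r - 1 - 1)) else 0) := by
      intro γ
      rw [← lintegral_const_mul _
        (Measurable.ite (measurableSet_lt measurable_const hF) hF measurable_const)]
      refine lintegral_congr fun t => ?_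
      split_ifs <;> simp [mul_comm]
    simp_rw [h3]
    rw [lintegral_lintegral_swap]
    exact ((hF.comp measurable_snd).mul
      (Measurable.ite (hmeas' hF) ((hpow _).comp measurable_fst) measurable_const)).aemeasurable
  have h3 : ∫⁻ x, u x ^ r / ENNReal.ofReal r ≤
      ∫⁻ t, F t * (F t ^ (r - 1) / ENNReal.ofReal (r - 1)) := by
    rw [h1, ← h2]
    refine setLIntegral_mono' measurableSet_Ioi fun γ hγ => ?_
    refine (mul_le_mul_right (h γ hγ) _).trans (le_of_eq ?_)
    rw [← mul_assoc, ← ENNReal.ofReal_mul (Real.rpow_nonneg (le_of_lt hγ) _),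
      Real.rpow_sub_one (ne_of_gt hγ) (r - 1), div_eq_mul_inv]
  have h4 : ∀ t, F t * (F t ^ (r - 1) / ENNReal.ofReal (r - 1)) =
      F t ^ r / ENNReal.ofReal (r - 1) := by
    intro t
    rw [← mul_div_assoc]
    congr 1
    have := ENNReal.rpow_add_of_nonneg (x := F t) 1 (r - 1) zero_le_one hr1.le
    rw [ENNReal.rpow_one, add_sub_cancel] at this
    exact this.symm
  simp_rw [h4, div_eq_mul_inv] at h3
  rw [lintegral_mul_const' _ _ (by simp [hr0]), lintegral_mul_const' _ _ (by simp [hr]),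
    ← div_eq_mul_inv, ENNReal.div_le_iff (by simp [hr0]) (by simp)] at h3
  refine h3.trans (le_of_eq ?_)
  rw [ENNReal.ofReal_div_of_pos hr1, div_eq_mul_inv]
  ring

/-! ### The Hardy-Littlewood-Sobolev inequality on the line -/

/-- The part of the Riesz kernel on the ball of radius `δ`, as a function of the distance `u ≥ 0`
from the singularity; it is only evaluated at `u = |x - t|`. -/
noncomputable def nearKernel (α δ u : ℝ) : ℝ≥0∞ :=
  if u < δ then ENNReal.ofReal (u ^ (α - 1)) else 0

/-- The part of the Riesz kernel outside the ball of radius `δ`, as a function of the distance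
`u ≥ 0` from the singularity. -/
noncomputable def farKernel (α δ u : ℝ) : ℝ≥0∞ :=
  if u < δ then 0 else ENNReal.ofReal (u ^ (α - 1))

/-- The Riesz potential on the line of a nonnegative function, with values in `[0, ∞]`. At `t = x` the
kernel takes the junk value `0 ^ (α - 1) = 0` (for `α ≠ 1`), on a null set. -/
noncomputable def rieszLIntegral (α : ℝ) (F : ℝ → ℝ≥0∞) (x : ℝ) : ℝ≥0∞ :=
  ∫⁻ t, F t * ENNReal.ofReal (|x - t| ^ (α - 1))

theorem measurable_ofReal_rpow (c : ℝ) : Measurable fun u : ℝ => ENNReal.ofReal (u ^ c) :=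
  ENNReal.measurable_ofReal.comp (measurable_id.pow_const c)

theorem measurable_nearKernel (α δ : ℝ) : Measurable (nearKernel α δ) :=
  Measurable.ite measurableSet_Iio (measurable_ofReal_rpow _) measurable_const

theorem measurable_farKernel (α δ : ℝ) : Measurable (farKernel α δ) :=
  Measurable.ite measurableSet_Iio measurable_const (measurable_ofReal_rpow _)

theorem measurable_abs_sub : Measurable fun z : ℝ × ℝ => |z.1 - z.2| :=
  (continuous_fst.sub continuous_snd).abs.measurable

theorem measurable_rieszLIntegral (α : ℝ) {F : ℝ → ℝ≥0∞} (hF : Measurable F) :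
    Measurable (rieszLIntegral α F) :=
  Measurable.lintegral_prod_right'
    (f := fun z : ℝ × ℝ => F z.2 * ENNReal.ofReal (|z.1 - z.2| ^ (α - 1)))
    ((hF.comp measurable_snd).mul ((measurable_ofReal_rpow _).comp measurable_abs_sub))

theorem lintegral_nearKernel {α : ℝ} (hα : 0 < α) {δ : ℝ} (hδ : 0 < δ) (x : ℝ) :
    ∫⁻ t, nearKernel α δ |x - t| = ENNReal.ofReal (2 / α * δ ^ α) := by
  rw [lintegral_comp_abs_sub, show 2 / α * δ ^ α = 2 * (δ ^ α / α) by ring,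
    ENNReal.ofReal_mul zero_le_two, ENNReal.ofReal_ofNat, ← lintegral_Ioo_rpow_sub_one hα hδ.le,
    ← Ioi_inter_Iio, inter_comm, ← setLIntegral_indicator measurableSet_Iio]
  simp only [indicator, mem_Iio, nearKernel]

theorem lintegral_farKernel_rpow {α r : ℝ} (hr : 1 < r) (hαr : α * r < 1) {δ : ℝ} (hδ : 0 < δ)
    (x : ℝ) :
    ∫⁻ t, farKernel α δ |x - t| ^ (r / (r - 1)) =
      ENNReal.ofReal (2 * (r - 1) / (1 - α * r) * δ ^ (-((1 - α * r) / (r - 1)))) := by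
  have hr1 : 0 < r - 1 := by linarith
  have hαr' : 0 < 1 - α * r := by linarith
  have hc : (α - 1) * (r / (r - 1)) + 1 = -((1 - α * r) / (r - 1)) := by field_simp; ring
  have hpos : 0 < (1 - α * r) / (r - 1) := div_pos hαr' hr1
  rw [lintegral_comp_abs_sub (fun u => farKernel α δ u ^ (r / (r - 1)))]
  have h1 := lintegral_Ioi_rpow_of_lt (c := (α - 1) * (r / (r - 1))) (by linarith) hδ
  rw [hc, neg_neg] at h1
  rw [show 2 * (r - 1) / (1 - α * r) * δ ^ (-((1 - α * r) / (r - 1))) =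
    2 * (δ ^ (-((1 - α * r) / (r - 1))) / ((1 - α * r) / (r - 1))) by field_simp,
    ENNReal.ofReal_mul zero_le_two, ENNReal.ofReal_ofNat, ← h1]
  congr 1
  rw [setLIntegral_congr (Ioi_ae_eq_Ici (a := δ)),
    ← inter_eq_self_of_subset_left (Ici_subset_Ioi.2 hδ), ← setLIntegral_indicator measurableSet_Ici]
  refine setLIntegral_congr_fun measurableSet_Ioi fun u (hu : 0 < u) => ?_
  by_cases h : u < δ
  · simp [farKernel, h, (div_pos (by linarith : 0 < r) hr1)]
  · simp only [farKernel, h, if_false, indicator, mem_Ici, not_lt.1 h, if_true]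
    rw [ENNReal.ofReal_rpow_of_nonneg (Real.rpow_nonneg hu.le _) (by positivity),
      ← Real.rpow_mul hu.le]

/-- The pointwise estimate behind the Hardy-Littlewood-Sobolev inequality. At height `γ` the kernel
is cut at `δ = γ ^ (-r)`, which balances the bounded part of `F` against the near kernel and the
whole of `F` (in `L^r`) against the far kernel. -/
theorem rieszLIntegral_le {α r : ℝ} (hα : 0 < α) (hr : 1 < r) (hαr : α * r < 1) {F : ℝ → ℝ≥0∞}
    (hF : Measurable F) (hF1 : ∫⁻ t, F t ^ r ≤ 1) {γ : ℝ} (hγ : 0 < γ) (x : ℝ) :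
    rieszLIntegral α F x ≤
      ENNReal.ofReal ((2 / α + (2 * (r - 1) / (1 - α * r)) ^ ((r - 1) / r)) * γ ^ (1 - α * r)) +
      ∫⁻ t, (if ENNReal.ofReal γ < F t then F t else 0) * nearKernel α (γ ^ (-r)) |x - t| := by
  have hr1 : 0 < r - 1 := by linarith
  have hr0 : 0 < r := by linarith
  have hαr' : 0 < 1 - α * r := by linarith
  have hδ : 0 < γ ^ (-r) := Real.rpow_pos_of_pos hγ _
  have hm : Measurable fun t : ℝ => |x - t| := (continuous_const.sub continuous_id).abs.measurable
  have hN : Measurable fun t => nearKernel α (γ ^ (-r)) |x - t| :=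
    (measurable_nearKernel α (γ ^ (-r))).comp hm
  have hR : Measurable fun t => farKernel α (γ ^ (-r)) |x - t| :=
    (measurable_farKernel α (γ ^ (-r))).comp hm
  have hnear : ∫⁻ t, ENNReal.ofReal γ * nearKernel α (γ ^ (-r)) |x - t| =
      ENNReal.ofReal (2 / α * γ ^ (1 - α * r)) := by
    rw [lintegral_const_mul _ hN, lintegral_nearKernel hα hδ, ← ENNReal.ofReal_mul hγ.le]
    congr 1
    rw [← Real.rpow_mul hγ.le, sub_eq_add_neg, Real.rpow_add hγ, Real.rpow_one,
      show -r * α = -(α * r) by ring]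
    ring
  have hfar : ∫⁻ t, F t * farKernel α (γ ^ (-r)) |x - t| ≤
      ENNReal.ofReal ((2 * (r - 1) / (1 - α * r)) ^ ((r - 1) / r) * γ ^ (1 - α * r)) := by
    have hconj : r.HolderConjugate (r / (r - 1)) := Real.HolderConjugate.conjExponent hr
    refine (ENNReal.lintegral_mul_le_Lp_mul_Lq volume hconj hF.aemeasurable
      hR.aemeasurable).trans ?_
    have h1 : (∫⁻ t, F t ^ r) ^ (1 / r) ≤ 1 := ENNReal.rpow_le_one hF1 (by positivity)
    refine (mul_le_mul_left h1 _).trans (le_of_eq ?_)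
    rw [one_mul, lintegral_farKernel_rpow hr hαr hδ,
      ENNReal.ofReal_rpow_of_nonneg (by positivity) (by positivity),
      Real.mul_rpow (by positivity) (by positivity), one_div_div, ← Real.rpow_mul hγ.le,
      ← Real.rpow_mul hγ.le]
    congr 3
    field_simp
  rw [add_mul, ENNReal.ofReal_add (by positivity) (by positivity), ← hnear, add_assoc,
    add_comm (ENNReal.ofReal _)]
  refine le_trans ?_ (add_le_add_right (add_le_add_right hfar _) _)
  rw [rieszLIntegral, ← lintegral_add_right _
    (show Measurable fun t => F t * farKernel α (γ ^ (-r)) |x - t| from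
    hF.mul hR),
    ← lintegral_add_left (hN.const_mul _)]
  refine lintegral_mono fun t => ?_
  simp only [nearKernel, farKernel]
  split_ifs with h1 h2
  · simp
  · simpa using mul_le_mul_left (not_lt.1 h2) _
  · simp
  · simp

/-- A truncated weak type bound for the Riesz potential, from the pointwise estimate and Markov's
inequality for the near part. -/
theorem meas_lt_rieszLIntegral_le {α r K : ℝ} (hα : 0 < α) (hr : 1 < r) (hαr : α * r < 1)
    (hK : 2 / α + (2 * (r - 1) / (1 - α * r)) ^ ((r - 1) / r) ≤ K) {F : ℝ → ℝ≥0∞}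
    (hF : Measurable F) (hF1 : ∫⁻ t, F t ^ r ≤ 1) {γ : ℝ} (hγ : 0 < γ) :
    volume {x | ENNReal.ofReal (2 * K * γ ^ (1 - α * r)) < rieszLIntegral α F x} ≤
      ENNReal.ofReal γ⁻¹ * ∫⁻ t, if ENNReal.ofReal γ < F t then F t else 0 := by
  have hr0 : 0 < r := by linarith
  have hr1 : 0 < r - 1 := by linarith
  have hαr' : 0 < 1 - α * r := by linarith
  have hK0 : 2 / α ≤ K := le_trans (le_add_of_nonneg_right (by positivity)) hK
  have hKpos : 0 < K := lt_of_lt_of_le (by positivity) hK0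
  have hδ : 0 < γ ^ (-r) := Real.rpow_pos_of_pos hγ _
  set E := ENNReal.ofReal (K * γ ^ (1 - α * r)) with hE
  have hEpos : 0 < K * γ ^ (1 - α * r) := by positivity
  set G : ℝ → ℝ≥0∞ := fun t => if ENNReal.ofReal γ < F t then F t else 0 with hG
  have hGm : Measurable G := Measurable.ite (measurableSet_lt measurable_const hF) hF measurable_const
  have hNm : Measurable fun z : ℝ × ℝ => G z.2 * nearKernel α (γ ^ (-r)) |z.1 - z.2| :=
    (hGm.comp measurable_snd).mul ((measurable_nearKernel _ _).comp measurable_abs_sub)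
  have hsub : {x | ENNReal.ofReal (2 * K * γ ^ (1 - α * r)) < rieszLIntegral α F x} ⊆
      {x | E ≤ ∫⁻ t, G t * nearKernel α (γ ^ (-r)) |x - t|} := by
    intro x hx
    simp only [mem_ofPred_eq] at hx ⊢
    by_contra! hcon
    refine absurd (hx.trans_le (rieszLIntegral_le hα hr hαr hF hF1 hγ x)) (not_lt.2 ?_)
    rw [show 2 * K * γ ^ (1 - α * r) = K * γ ^ (1 - α * r) + K * γ ^ (1 - α * r) by ring,
      ENNReal.ofReal_add hEpos.le hEpos.le]
    refine add_le_add (ENNReal.ofReal_le_ofReal ?_) hcon.le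
    gcongr
  have hint : ∫⁻ x, ∫⁻ t, G t * nearKernel α (γ ^ (-r)) |x - t| =
      ENNReal.ofReal (2 / α * (γ ^ (-r)) ^ α) * ∫⁻ t, G t := by
    rw [lintegral_lintegral_swap hNm.aemeasurable, ← lintegral_const_mul _ hGm]
    refine lintegral_congr fun t => ?_
    rw [lintegral_const_mul, mul_comm, ← lintegral_nearKernel hα hδ t]
    · simp only [abs_sub_comm]
    · exact (measurable_nearKernel _ _).comp
        (continuous_id.sub continuous_const).abs.measurable
  have hmarkov := mul_meas_ge_le_lintegral (μ := volume) (hNm.lintegral_prod_right' (ν := volume)) E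
  rw [hint] at hmarkov
  refine (measure_mono hsub).trans ?_
  have hE0 : E ≠ 0 := by simpa [hE] using hEpos
  rw [mul_comm, ← ENNReal.le_div_iff_mul_le (Or.inl hE0) (Or.inl ENNReal.ofReal_ne_top)] at hmarkov
  refine hmarkov.trans ?_
  rw [div_eq_mul_inv, mul_comm, ← mul_assoc]
  refine mul_le_mul_left ?_ _
  rw [hE, ← ENNReal.ofReal_inv_of_pos hEpos, ← ENNReal.ofReal_mul (by positivity)]
  refine ENNReal.ofReal_le_ofReal ?_
  rw [← Real.rpow_mul hγ.le, sub_eq_add_neg, Real.rpow_add hγ, Real.rpow_one,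
    show -r * α = -(α * r) by ring]
  have : 0 < γ ^ (-(α * r)) := by positivity
  rw [inv_mul_le_iff₀ (by positivity)]
  field_simp
  rwa [div_le_iff₀ hα, mul_comm] at hK0

/-- The Hardy-Littlewood-Sobolev inequality for normalized `F`. Parametrizing the heights of the
potential as `2 K γ ^ (1 - α r)` turns the off-diagonal weak type bound into one of type `(1, 1)`, to
which the diagonal interpolation step applies. -/
theorem lintegral_rieszLIntegral_rpow_le_of_le_one {α r K : ℝ} (hα : 0 < α) (hr : 1 < r)
    (hαr : α * r < 1) (hK : 2 / α + (2 * (r - 1) / (1 - α * r)) ^ ((r - 1) / r) ≤ K)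
    {F : ℝ → ℝ≥0∞} (hF : Measurable F) (hF1 : ∫⁻ t, F t ^ r ≤ 1) :
    ∫⁻ x, rieszLIntegral α F x ^ (r / (1 - α * r)) ≤
      ENNReal.ofReal (2 * K) ^ (r / (1 - α * r)) * ENNReal.ofReal (r / (r - 1)) := by
  have hr0 : 0 < r := by linarith
  have hr1 : 0 < r - 1 := by linarith
  have hαr' : 0 < 1 - α * r := by linarith
  have hK0 : 2 / α ≤ K := le_trans (le_add_of_nonneg_right (by positivity)) hK
  have hKpos : 0 < K := lt_of_lt_of_le (by positivity) hK0
  have hA0 : ENNReal.ofReal (2 * K) ≠ 0 := by simpa using hKpos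
  have hJm := measurable_rieszLIntegral α hF
  have hinv : 0 < 1 / (1 - α * r) := by positivity
  have key := lintegral_rpow_le_of_meas_lt_le
    (u := fun x => (rieszLIntegral α F x / ENNReal.ofReal (2 * K)) ^ (1 / (1 - α * r)))
    ((hJm.div_const _).pow_const _) hF hr fun γ hγ => ?_
  · have hdiv : ∀ x, ((rieszLIntegral α F x / ENNReal.ofReal (2 * K)) ^ (1 / (1 - α * r))) ^ r =
        rieszLIntegral α F x ^ (r / (1 - α * r)) *
          (ENNReal.ofReal (2 * K) ^ (r / (1 - α * r)))⁻¹ := fun x => by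
      rw [← ENNReal.rpow_mul, one_div_mul_eq_div,
        ENNReal.div_rpow_of_nonneg _ _ (show 0 ≤ r / (1 - α * r) by positivity), div_eq_mul_inv]
    simp_rw [hdiv] at key
    have hB0 : ENNReal.ofReal (2 * K) ^ (r / (1 - α * r)) ≠ 0 :=
      (ENNReal.rpow_pos (pos_iff_ne_zero.2 hA0) ENNReal.ofReal_ne_top).ne'
    have hBt : ENNReal.ofReal (2 * K) ^ (r / (1 - α * r)) ≠ ⊤ :=
      ENNReal.rpow_ne_top_of_nonneg (by positivity) ENNReal.ofReal_ne_top
    rw [lintegral_mul_const' _ _ (ENNReal.inv_ne_top.2 hB0), ← div_eq_mul_inv,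
      ENNReal.div_le_iff hB0 hBt, mul_comm _ (ENNReal.ofReal (2 * K) ^ _)] at key
    refine key.trans (mul_le_mul_right ?_ _)
    simpa using mul_le_mul_right hF1 (ENNReal.ofReal (r / (r - 1)))
  · refine le_trans (measure_mono fun x hx => ?_) (meas_lt_rieszLIntegral_le hα hr hαr hK hF hF1 hγ)
    simp only [mem_ofPred_eq] at hx ⊢
    rw [one_div, ENNReal.lt_rpow_inv_iff hαr', ENNReal.lt_div_iff_mul_lt (Or.inl hA0)
      (Or.inl ENNReal.ofReal_ne_top), ENNReal.ofReal_rpow_of_pos hγ, mul_comm,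
      ← ENNReal.ofReal_mul (by positivity)] at hx
    exact hx

/-- The **Hardy-Littlewood-Sobolev inequality** on the line, with an explicit constant. -/
theorem rieszLIntegral_Lp_le {α r K : ℝ} (hα : 0 < α) (hr : 1 < r)
    (hαr : α * r < 1) (hK : 2 / α + (2 * (r - 1) / (1 - α * r)) ^ ((r - 1) / r) ≤ K)
    {F : ℝ → ℝ≥0∞} (hF : Measurable F) :
    (∫⁻ x, rieszLIntegral α F x ^ (r / (1 - α * r))) ^ (1 / (r / (1 - α * r))) ≤
      ENNReal.ofReal (2 * K * (r / (r - 1))) * (∫⁻ t, F t ^ r) ^ (1 / r) := by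
  have hr0 : 0 < r := by linarith
  have hr1 : 0 < r - 1 := by linarith
  have hαr' : 0 < 1 - α * r := by linarith
  have hK0 : 2 / α ≤ K := le_trans (le_add_of_nonneg_right (by positivity)) hK
  have hKpos : 0 < K := lt_of_lt_of_le (by positivity) hK0
  set s := r / (1 - α * r) with hs
  have hs1 : 1 < s := by
    rw [hs, one_lt_div hαr']
    nlinarith
  have hs0 : 0 < s := by linarith
  set N := (∫⁻ t, F t ^ r) ^ (1 / r) with hN
  have hNr : N ^ r = ∫⁻ t, F t ^ r := by
    rw [hN, ← ENNReal.rpow_mul, one_div_mul_cancel hr0.ne', ENNReal.rpow_one]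
  rcases eq_or_ne N 0 with h0 | h0
  · have hFz : F =ᵐ[volume] 0 := by
      rw [h0, ENNReal.zero_rpow_of_pos hr0, eq_comm, lintegral_eq_zero_iff (hF.pow_const _)] at hNr
      filter_upwards [hNr] with t ht
      simpa [hr0, hr0.not_gt] using ht
    have : ∀ x, rieszLIntegral α F x = 0 := fun x => by
      rw [rieszLIntegral, lintegral_congr_ae (g := fun _ => 0), lintegral_zero]
      filter_upwards [hFz] with t ht
      simp [ht]
    simp [this, hs0, h0]
  rcases eq_or_ne N ⊤ with ht | ht
  · rw [ht, ENNReal.mul_top]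
    · exact le_top
    · simp only [ne_eq, ENNReal.ofReal_eq_zero, not_le]
      positivity
  have hscale : ∫⁻ t, (N⁻¹ * F t) ^ r ≤ 1 := by
    simp_rw [ENNReal.mul_rpow_of_nonneg _ _ hr0.le]
    rw [lintegral_const_mul _ (hF.pow_const _), ← hNr, ← ENNReal.mul_rpow_of_nonneg _ _ hr0.le,
      ENNReal.inv_mul_cancel h0 ht, ENNReal.one_rpow]
  have key := lintegral_rieszLIntegral_rpow_le_of_le_one hα hr hαr hK (hF.const_mul N⁻¹) hscale
  have hJ : ∀ x, rieszLIntegral α (fun t => N⁻¹ * F t) x = N⁻¹ * rieszLIntegral α F x := by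
    intro x
    simp_rw [rieszLIntegral, mul_assoc]
    exact lintegral_const_mul' _ _ (ENNReal.inv_ne_top.2 h0)
  rw [← hs] at key
  simp_rw [hJ, ENNReal.mul_rpow_of_nonneg _ _ hs0.le] at key
  rw [lintegral_const_mul _ ((measurable_rieszLIntegral α hF).pow_const _)] at key
  have key2 := ENNReal.rpow_le_rpow key (show 0 ≤ 1 / s by positivity)
  rw [ENNReal.mul_rpow_of_nonneg _ _ (by positivity), ENNReal.mul_rpow_of_nonneg _ _ (by positivity),
    ← ENNReal.rpow_mul, ← ENNReal.rpow_mul, mul_one_div_cancel hs0.ne', ENNReal.rpow_one,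
    ENNReal.rpow_one, mul_comm, ← div_eq_mul_inv, ENNReal.div_le_iff h0 ht] at key2
  refine key2.trans (mul_le_mul_left ?_ _)
  rw [ENNReal.ofReal_mul (show 0 ≤ 2 * K by positivity)]
  refine mul_le_mul_right ?_ _
  -- the factor `r / (r - 1)` exceeds `1`, so its root of order `s > 1` may be dropped
  have h1 : (1 : ℝ≥0∞) ≤ ENNReal.ofReal (r / (r - 1)) := by
    rw [ENNReal.one_le_ofReal, one_le_div hr1]
    linarith
  calc ENNReal.ofReal (r / (r - 1)) ^ (1 / s) ≤ ENNReal.ofReal (r / (r - 1)) ^ (1 : ℝ) :=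
        ENNReal.rpow_le_rpow_of_exponent_le h1 (by rw [div_le_one hs0]; exact hs1.le)
    _ = _ := ENNReal.rpow_one _

/-! ### The potentials on the unit interval -/

namespace PotentialKind

theorem integrand_eq (T : PotentialKind) (α : ℝ) (f : ℝ → ℝ) {x t : ℝ} (ht : t ∈ T.domain x) :
    T.integrand α f x t = f t / |x - t| ^ (1 - α) := by
  cases T with
  | I => rfl
  | R => rw [integrand, abs_of_pos (sub_pos.2 ht.2)]
  | W => rw [integrand, abs_sub_comm, abs_of_pos (sub_pos.2 ht.1)]

theorem domain_subset (T : PotentialKind) {x : ℝ} (hx : x ∈ Icc (0 : ℝ) 1) :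
    T.domain x ⊆ Icc 0 1 := by
  cases T with
  | I => exact Ioo_subset_Icc_self
  | R => exact fun t ht => ⟨ht.1.le, ht.2.le.trans hx.2⟩
  | W => exact fun t ht => ⟨hx.1.trans ht.1.le, ht.2.le⟩

theorem measurableSet_domain (T : PotentialKind) (x : ℝ) : MeasurableSet (T.domain x) := by
  cases T <;> exact measurableSet_Ioo

theorem measurableSet_domain_prod (T : PotentialKind) :
    MeasurableSet {z : ℝ × ℝ | z.2 ∈ T.domain z.1} := by
  cases T with
  | I => exact measurable_snd measurableSet_Ioo
  | R =>
    exact (measurable_snd (measurableSet_Ioi (a := (0 : ℝ)))).inter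
      (measurableSet_lt measurable_snd measurable_fst)
  | W =>
    exact (measurableSet_lt measurable_fst measurable_snd).inter
      (measurable_snd (measurableSet_Iio (a := (1 : ℝ))))

theorem enorm_integrand (T : PotentialKind) (α : ℝ) (f : ℝ → ℝ) {x t : ℝ} (ht : t ∈ T.domain x) :
    ‖T.integrand α f x t‖ₑ = ‖f t‖ₑ * ENNReal.ofReal (|x - t| ^ (α - 1)) := by
  rw [T.integrand_eq α f ht, div_eq_mul_inv, ← Real.rpow_neg (abs_nonneg _), neg_sub, enorm_mul,
    Real.enorm_of_nonneg (Real.rpow_nonneg (abs_nonneg _) _)]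

/-- Each of the three potentials is dominated by the Riesz potential on the line of a measurable
function `F` which is a version of `|f|` on `[0, 1]` and vanishes elsewhere. -/
theorem exists_lintegral_integrand_le (T : PotentialKind) (α : ℝ) {f : ℝ → ℝ}
    (hf : AEStronglyMeasurable f (volume.restrict (Icc 0 1))) :
    ∃ F : ℝ → ℝ≥0∞, Measurable F ∧
      (∀ r : ℝ, 0 < r → ∫⁻ t, F t ^ r = ∫⁻ t in Icc 0 1, ‖f t‖ₑ ^ r) ∧
      ∀ x ∈ Icc (0 : ℝ) 1,
        ∫⁻ t in T.domain x, ‖T.integrand α f x t‖ₑ ≤ rieszLIntegral α F x := by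
  have hae : ∀ᵐ t ∂(volume.restrict (Icc (0 : ℝ) 1)), f t = hf.mk f t := hf.ae_eq_mk
  refine ⟨(Icc 0 1).indicator fun t => ‖hf.mk f t‖ₑ,
    hf.stronglyMeasurable_mk.enorm.indicator measurableSet_Icc, fun r hr => ?_, fun x hx => ?_⟩
  · rw [← lintegral_indicator measurableSet_Icc]
    rw [ae_restrict_iff' measurableSet_Icc] at hae
    refine lintegral_congr_ae ?_
    filter_upwards [hae] with t ht
    by_cases h : t ∈ Icc (0 : ℝ) 1
    · simp [indicator_of_mem h, ht h]
    · simp [indicator_of_notMem h, hr]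
  · rw [rieszLIntegral]
    refine le_trans (lintegral_mono_ae ?_) (setLIntegral_le_lintegral (T.domain x) _)
    filter_upwards [ae_restrict_of_ae_restrict_of_subset (T.domain_subset hx) hae,
      ae_restrict_mem (T.measurableSet_domain x)] with t ht htd
    rw [T.enorm_integrand α f htd, indicator_of_mem (T.domain_subset hx htd), ht]

theorem aestronglyMeasurable_integrand (T : PotentialKind) (α : ℝ) {f : ℝ → ℝ}
    (hf : AEStronglyMeasurable f (volume.restrict (Icc 0 1))) {x : ℝ} (hx : x ∈ Icc (0 : ℝ) 1) :
    AEStronglyMeasurable (T.integrand α f x) (volume.restrict (T.domain x)) := by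
  have h1 : AEStronglyMeasurable (fun t => f t / |x - t| ^ (1 - α))
      (volume.restrict (T.domain x)) :=
    (hf.mono_measure (Measure.restrict_mono (T.domain_subset hx) le_rfl)).aemeasurable.div
      (((continuous_const.sub continuous_id).abs.measurable.pow_const _).aemeasurable)
      |>.aestronglyMeasurable
  refine h1.congr ?_
  filter_upwards [ae_restrict_mem (T.measurableSet_domain x)] with t ht
  rw [T.integrand_eq α f ht]

theorem aestronglyMeasurable_op (T : PotentialKind) (α : ℝ) {f : ℝ → ℝ}
    (hf : AEStronglyMeasurable f (volume.restrict (Icc 0 1))) :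
    AEStronglyMeasurable (T.op α f) (volume.restrict (Icc 0 1)) := by
  have hm : StronglyMeasurable ({z : ℝ × ℝ | z.2 ∈ T.domain z.1}.indicator
      fun z => hf.mk f z.2 / |z.1 - z.2| ^ (1 - α)) :=
    ((hf.stronglyMeasurable_mk.measurable.comp measurable_snd).div
      (measurable_abs_sub.pow_const _)).stronglyMeasurable.indicator T.measurableSet_domain_prod
  refine ⟨_, hm.integral_prod_right' (ν := volume), ?_⟩
  filter_upwards [ae_restrict_mem measurableSet_Icc] with x hx
  rw [op, ← integral_indicator (T.measurableSet_domain x)]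
  have hae : ∀ᵐ t ∂(volume.restrict (Icc (0 : ℝ) 1)), f t = hf.mk f t := hf.ae_eq_mk
  rw [ae_restrict_iff' measurableSet_Icc] at hae
  refine integral_congr_ae ?_
  filter_upwards [hae] with t ht
  by_cases h : t ∈ T.domain x
  · rw [indicator_of_mem h, indicator_of_mem (show (x, t) ∈ {z : ℝ × ℝ | z.2 ∈ T.domain z.1} from h),
      T.integrand_eq α f h, ht (T.domain_subset hx h)]
  · rw [indicator_of_notMem h,
      indicator_of_notMem (show (x, t) ∉ {z : ℝ × ℝ | z.2 ∈ T.domain z.1} from h)]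

/-- The potentials are of strong type `(r, r / (1 - α r))`, with a constant which is uniform for
`r` in a compact subinterval `[r₀, p]` of `(1, 1 / α)`. -/
theorem exists_eLpNorm'_op_le (T : PotentialKind) {α p r₀ : ℝ} (hα : 0 < α) (hp : α * p < 1)
    (hr₀ : 1 < r₀) (hr₀p : r₀ ≤ p) :
    ∃ A : ℝ, 0 < A ∧ ∀ r, r₀ ≤ r → r ≤ p → ∀ f : ℝ → ℝ,
      AEStronglyMeasurable f (volume.restrict (Icc 0 1)) →
        eLpNorm' (T.op α f) (r / (1 - α * r)) (volume.restrict (Icc 0 1)) ≤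
          ENNReal.ofReal A * eLpNorm' f r (volume.restrict (Icc 0 1)) := by
  have hp' : 0 < 1 - α * p := by linarith
  have hp1 : 0 < p - 1 := by linarith
  have hr₀1 : 0 < r₀ - 1 := by linarith
  refine ⟨2 * (2 / α + (1 + 2 * (p - 1) / (1 - α * p))) * (r₀ / (r₀ - 1)), by positivity,
    fun r hr₀r hrp f hf => ?_⟩
  have hr1 : 0 < r - 1 := by linarith
  have hr0 : 0 < r := by linarith
  have hαr : α * r ≤ α * p := mul_le_mul_of_nonneg_left hrp hα.le
  have hr' : 0 < 1 - α * r := by linarith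
  obtain ⟨F, hF, hFr, hFJ⟩ := T.exists_lintegral_integrand_le α hf
  have hK : 2 / α + (2 * (r - 1) / (1 - α * r)) ^ ((r - 1) / r) ≤
      2 / α + (1 + 2 * (p - 1) / (1 - α * p)) := by
    have h1 : 2 * (r - 1) / (1 - α * r) ≤ 1 + 2 * (p - 1) / (1 - α * p) := by
      have : 2 * (r - 1) / (1 - α * r) ≤ 2 * (p - 1) / (1 - α * p) := by gcongr
      linarith
    -- adding `1` makes the base at least `1`, so that the exponent `(r - 1) / r ≤ 1` may be dropped
    have h2 : (1 : ℝ) ≤ 1 + 2 * (p - 1) / (1 - α * p) := le_add_of_nonneg_right (by positivity)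
    refine add_le_add le_rfl ((Real.rpow_le_rpow (by positivity) h1 (by positivity)).trans ?_)
    calc _ ≤ (1 + 2 * (p - 1) / (1 - α * p)) ^ (1 : ℝ) :=
          Real.rpow_le_rpow_of_exponent_le h2 (by rw [div_le_one hr0]; linarith)
      _ = _ := Real.rpow_one _
  have key := rieszLIntegral_Lp_le hα (by linarith : 1 < r) (by linarith) hK hF
  have hs : 0 < r / (1 - α * r) := by positivity
  calc _ ≤ (∫⁻ x, rieszLIntegral α F x ^ (r / (1 - α * r))) ^ (1 / (r / (1 - α * r))) := by
        refine ENNReal.rpow_le_rpow (le_trans ?_ (setLIntegral_le_lintegral (Icc 0 1) _))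
          (by positivity)
        exact setLIntegral_mono' measurableSet_Icc fun x hx =>
          ENNReal.rpow_le_rpow ((enorm_integral_le_lintegral_enorm _).trans (hFJ x hx)) hs.le
    _ ≤ _ := key
    _ ≤ _ := by
      rw [hFr r hr0, eLpNorm']
      refine mul_le_mul_left (ENNReal.ofReal_le_ofReal ?_) _
      refine mul_le_mul_of_nonneg_left ?_ (by positivity)
      rw [div_le_div_iff₀ hr1 hr₀1]
      nlinarith

end PotentialKind

/-! ### Grand Lebesgue norms on the unit interval -/

/-- The members of the supremum defining the grand norm are weighted Lebesgue norms. -/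
theorem ofReal_rpow_mul_eLpNorm' {θ ε s : ℝ} (hε : 0 < ε) (hs : 0 < s) (f : ℝ → ℝ) :
    (ENNReal.ofReal (ε ^ θ) / volume (Icc (0 : ℝ) 1) * ∫⁻ t in Icc (0 : ℝ) 1, ‖f t‖ₑ ^ s) ^
      (1 / s) = ENNReal.ofReal (ε ^ (θ / s)) * eLpNorm' f s (volume.restrict (Icc 0 1)) := by
  rw [Real.volume_Icc, sub_zero, ENNReal.ofReal_one, div_one,
    ENNReal.mul_rpow_of_nonneg _ _ (by positivity),
    ENNReal.ofReal_rpow_of_nonneg (Real.rpow_nonneg hε.le _) (by positivity),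
    ← Real.rpow_mul hε.le, mul_one_div, eLpNorm']

theorem le_grandNorm {p θ ε : ℝ} (h0 : 0 < ε) (h1 : ε < p - 1) (f : ℝ → ℝ) :
    ENNReal.ofReal (ε ^ (θ / (p - ε))) * eLpNorm' f (p - ε) (volume.restrict (Icc 0 1)) ≤
      grandNorm (Icc 0 1) p θ f := by
  rw [← ofReal_rpow_mul_eLpNorm' h0 (by linarith)]
  exact le_iSup₂ (f := fun (ε : ℝ) (_ : ε ∈ Ioo 0 (p - 1)) =>
    (ENNReal.ofReal (ε ^ θ) / volume (Icc (0 : ℝ) 1) *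
      ∫⁻ t in Icc (0 : ℝ) 1, ‖f t‖ₑ ^ (p - ε)) ^ (1 / (p - ε))) ε ⟨h0, h1⟩

theorem grandNorm_le {p θ : ℝ} {f : ℝ → ℝ} {M : ℝ≥0∞}
    (h : ∀ ε, 0 < ε → ε < p - 1 →
      ENNReal.ofReal (ε ^ (θ / (p - ε))) * eLpNorm' f (p - ε) (volume.restrict (Icc 0 1)) ≤ M) :
    grandNorm (Icc 0 1) p θ f ≤ M :=
  iSup₂_le fun ε hε => by
    rw [ofReal_rpow_mul_eLpNorm' hε.1 (by linarith [hε.2])]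
    exact h ε hε.1 hε.2

/-! ### Boundedness and almost everywhere convergence -/

/-- In terms of the gaps `ε = p / (1 - α p) - r / (1 - α r)` and `η = p - r`, which are comparable,
the weight in the target space is dominated by the weight in the source space. -/
theorem exists_rpow_gap_le {α p θ₁ θ₂ : ℝ} (hα : 0 < α) (hp : 1 < p) (hαp : α * p < 1)
    (hθ₁ : 0 < θ₁) (hθ : θ₁ / (1 - α * p) ≤ θ₂) :
    ∃ B : ℝ, 0 < B ∧ ∀ r, 1 < r → r < p →
      (p / (1 - α * p) - r / (1 - α * r)) ^ (θ₂ / (r / (1 - α * r))) ≤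
        B * (p - r) ^ (θ₁ / r) := by
  have hp' : 0 < 1 - α * p := by linarith
  have hθ₂ : 0 < θ₂ := lt_of_lt_of_le (by positivity) hθ
  have hD : 1 ≤ 1 / (1 - α * p) ^ 2 := by
    rw [le_div_iff₀ (by positivity), one_mul]
    have : 0 < α * p := by positivity
    exact pow_le_one₀ hp'.le (by linarith)
  refine ⟨(1 / (1 - α * p) ^ 2) ^ θ₂ * p ^ θ₂, by positivity, fun r hr hrp => ?_⟩
  have hr0 : 0 < r := by linarith
  have hαr : α * r < α * p := mul_lt_mul_of_pos_left hrp hα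
  have hr' : 0 < 1 - α * r := by linarith
  have hη : 0 < p - r := by linarith
  set s := r / (1 - α * r) with hs
  have hs1 : 1 ≤ s := by
    rw [hs, le_div_iff₀ hr']
    nlinarith
  have hs0 : 0 < s := by linarith
  have hε : p / (1 - α * p) - s = (p - r) / ((1 - α * p) * (1 - α * r)) := by
    rw [hs, div_sub_div _ _ hp'.ne' hr'.ne']
    congr 1
    ring
  have hε1 : p / (1 - α * p) - s ≤ 1 / (1 - α * p) ^ 2 * (p - r) := by
    rw [hε, one_div_mul_eq_div]
    refine div_le_div_of_nonneg_left hη.le (by positivity) ?_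
    nlinarith
  have hε0 : 0 ≤ p / (1 - α * p) - s := by
    rw [hε]
    positivity
  have hexp : θ₁ / r ≤ θ₂ / s := by
    rw [hs, div_div_eq_mul_div]
    refine div_le_div_of_nonneg_right ?_ hr0.le
    rw [div_le_iff₀ hp'] at hθ
    nlinarith
  have hexp2 : θ₂ / s ≤ θ₂ := div_le_self hθ₂.le hs1
  have h0 : 0 < θ₁ / r := by positivity
  calc (p / (1 - α * p) - s) ^ (θ₂ / s)
      ≤ (1 / (1 - α * p) ^ 2 * (p - r)) ^ (θ₂ / s) := Real.rpow_le_rpow hε0 hε1 (by positivity)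
    _ = (1 / (1 - α * p) ^ 2) ^ (θ₂ / s) *
        ((p - r) ^ (θ₂ / s - θ₁ / r) * (p - r) ^ (θ₁ / r)) := by
      rw [Real.mul_rpow (by positivity) hη.le, ← Real.rpow_add hη, sub_add_cancel]
    _ ≤ (1 / (1 - α * p) ^ 2) ^ θ₂ * (p ^ θ₂ * (p - r) ^ (θ₁ / r)) := by
      refine mul_le_mul (Real.rpow_le_rpow_of_exponent_le hD hexp2) ?_ (by positivity)
        (by positivity)
      refine mul_le_mul_of_nonneg_right ?_ (by positivity)
      exact (Real.rpow_le_rpow hη.le (by linarith : p - r ≤ p) (by linarith)).trans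
        (Real.rpow_le_rpow_of_exponent_le hp.le (by linarith))
    _ = _ := by ring

/-- For `θ₂` at or above the critical value, the target norms of exponent `s ≥ s₀ > 1` are controlled
by the uniform strong type bounds and the comparison of weights, and those of exponent `s < s₀` by
the one of exponent `s₀`, as `[0, 1]` has measure one. -/
theorem PotentialKind.boundedGrandLp_op (T : PotentialKind) {α p θ₁ θ₂ : ℝ} (hα : 0 < α)
    (hp : 1 < p) (hαp : α * p < 1) (hθ₁ : 0 < θ₁) (hθ : θ₁ / (1 - α * p) ≤ θ₂) :
    BoundedGrandLp (T.op α) p θ₁ (p / (1 - α * p)) θ₂ := by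
  have hp' : 0 < 1 - α * p := by linarith
  have hθ₂ : 0 < θ₂ := lt_of_lt_of_le (by positivity) hθ
  set q := p / (1 - α * p) with hq
  obtain ⟨r₀, hr₀, hr₀p⟩ := exists_between hp
  have hr₀' : 0 < 1 - α * r₀ := by nlinarith
  set s₀ := r₀ / (1 - α * r₀) with hs₀
  have hs₀0 : 0 < s₀ := by positivity
  have hs₀1 : 1 < s₀ := by
    rw [hs₀, lt_div_iff₀ hr₀']
    nlinarith
  have hs₀q : s₀ < q := by
    rw [hs₀, hq, div_lt_div_iff₀ hr₀' hp']
    nlinarith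
  obtain ⟨A, hA, hop⟩ := T.exists_eLpNorm'_op_le hα hαp hr₀ hr₀p.le
  obtain ⟨B, hB, hgap⟩ := exists_rpow_gap_le hα hp hαp hθ₁ hθ
  have hmain : ∀ f : ℝ → ℝ, AEStronglyMeasurable f (volume.restrict (Icc 0 1)) →
      ∀ s, s₀ ≤ s → s < q →
      ENNReal.ofReal ((q - s) ^ (θ₂ / s)) * eLpNorm' (T.op α f) s (volume.restrict (Icc 0 1)) ≤
        ENNReal.ofReal (B * A) * grandNorm (Icc 0 1) p θ₁ f := by
    intro f hf s hs hsq
    have hs0 : 0 < s := hs₀0.trans_le hs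
    -- the source exponent is determined by `1 / r = 1 / s + α`
    obtain ⟨r, hr1, hrp, rfl⟩ : ∃ r, r₀ ≤ r ∧ r < p ∧ s = r / (1 - α * r) := by
      have h1 : 0 < 1 + α * s := by positivity
      refine ⟨s / (1 + α * s), ?_, ?_, ?_⟩
      · rw [hs₀, div_le_iff₀ hr₀'] at hs
        rw [le_div_iff₀ h1]
        linarith
      · rw [hq, lt_div_iff₀ hp'] at hsq
        rw [div_lt_iff₀ h1]
        linarith
      · field_simp
        ring
    have hr0 : 0 < r := by linarith
    have h1 := hop r hr1 hrp.le f hf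
    have h2 := le_grandNorm (p := p) (θ := θ₁) (ε := p - r) (by linarith) (by linarith) f
    rw [sub_sub_cancel] at h2
    calc _ ≤ ENNReal.ofReal (B * (p - r) ^ (θ₁ / r)) *
          (ENNReal.ofReal A * eLpNorm' f r (volume.restrict (Icc 0 1))) :=
          mul_le_mul' (ENNReal.ofReal_le_ofReal (hgap r (by linarith) hrp)) h1
      _ = ENNReal.ofReal (B * A) * (ENNReal.ofReal ((p - r) ^ (θ₁ / r)) *
          eLpNorm' f r (volume.restrict (Icc 0 1))) := by
        rw [ENNReal.ofReal_mul hB.le, ENNReal.ofReal_mul hB.le]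
        ring
      _ ≤ _ := mul_le_mul_right h2 _
  have hε₀ : 0 < q - s₀ := by linarith
  have hW : 0 < (q - s₀) ^ (θ₂ / s₀) := by positivity
  have hq1 : 1 < q := by linarith
  set C₁ := q ^ θ₂ * ((q - s₀) ^ (θ₂ / s₀))⁻¹ * (B * A) with hC₁
  have hprob : IsProbabilityMeasure (volume.restrict (Icc (0 : ℝ) 1)) := ⟨by simp⟩
  have hfin : ∀ f : ℝ → ℝ, AEStronglyMeasurable f (volume.restrict (Icc 0 1)) →
      grandNorm (Icc 0 1) q θ₂ (T.op α f) ≤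
        ENNReal.ofReal (B * A + C₁) * grandNorm (Icc 0 1) p θ₁ f := by
    intro f hf
    rw [ENNReal.ofReal_add (by positivity) (by positivity), add_mul]
    refine grandNorm_le fun ε hε0 hε1 => ?_
    rcases le_or_gt s₀ (q - ε) with hs | hs
    · refine le_trans ?_ le_self_add
      have := hmain f hf (q - ε) hs (by linarith)
      rwa [sub_sub_cancel] at this
    · refine le_trans ?_ le_add_self
      have hs1 : 1 < q - ε := by linarith
      have h1 : ε ^ (θ₂ / (q - ε)) ≤ q ^ θ₂ :=
        (Real.rpow_le_rpow hε0.le (by linarith) (by positivity)).trans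
          (Real.rpow_le_rpow_of_exponent_le hq1.le (div_le_self hθ₂.le hs1.le))
      have h2 := eLpNorm'_le_eLpNorm'_of_exponent_le (by linarith : 0 < q - ε) hs.le
        (volume.restrict (Icc (0 : ℝ) 1)) (T.aestronglyMeasurable_op α hf)
      calc _ ≤ ENNReal.ofReal (q ^ θ₂) * eLpNorm' (T.op α f) s₀ (volume.restrict (Icc 0 1)) :=
            mul_le_mul' (ENNReal.ofReal_le_ofReal h1) h2
        _ = ENNReal.ofReal (q ^ θ₂ * ((q - s₀) ^ (θ₂ / s₀))⁻¹) *
            (ENNReal.ofReal ((q - s₀) ^ (θ₂ / s₀)) *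
              eLpNorm' (T.op α f) s₀ (volume.restrict (Icc 0 1))) := by
          rw [← mul_assoc, ← ENNReal.ofReal_mul (by positivity), mul_assoc (q ^ θ₂),
            inv_mul_cancel₀ hW.ne', mul_one]
        _ ≤ ENNReal.ofReal (q ^ θ₂ * ((q - s₀) ^ (θ₂ / s₀))⁻¹) *
            (ENNReal.ofReal (B * A) * grandNorm (Icc 0 1) p θ₁ f) :=
          mul_le_mul_right (hmain f hf s₀ le_rfl hs₀q) _
        _ = _ := by rw [← mul_assoc, ← ENNReal.ofReal_mul (by positivity)]
  exact ⟨(B * A + C₁).toNNReal, fun f hf => ⟨⟨T.aestronglyMeasurable_op α hf.1,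
    (hfin f hf.1).trans_lt (ENNReal.mul_lt_top ENNReal.ofReal_lt_top hf.2)⟩, hfin f hf.1⟩⟩

theorem MemGrandLp.eLpNorm'_lt_top {p θ r : ℝ} (hr : 1 < r) (hrp : r < p) {f : ℝ → ℝ}
    (hf : MemGrandLp (Icc 0 1) p θ f) : eLpNorm' f r (volume.restrict (Icc 0 1)) < ⊤ := by
  have h := (le_grandNorm (p := p) (θ := θ) (ε := p - r) (by linarith) (by linarith) f).trans_lt
    hf.2
  rw [sub_sub_cancel] at h
  refine lt_top_iff_ne_top.2 fun htop => ?_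
  have hpos : 0 < (p - r) ^ (θ / r) := Real.rpow_pos_of_pos (by linarith) _
  rw [htop, ENNReal.mul_top (by simpa using hpos)] at h
  exact lt_irrefl _ h

theorem PotentialKind.ae_integrableOn_integrand (T : PotentialKind) {α p θ : ℝ} (hα : 0 < α)
    (hp : 1 < p) (hαp : α * p < 1) {f : ℝ → ℝ} (hf : MemGrandLp (Icc 0 1) p θ f) :
    ∀ᵐ x ∂(volume.restrict (Icc (0 : ℝ) 1)),
      IntegrableOn (T.integrand α f x) (T.domain x) volume := by
  obtain ⟨r, hr, hrp⟩ := exists_between hp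
  have hr' : 0 < 1 - α * r := by nlinarith
  have hr0 : 0 < r := by linarith
  have hs : 0 < r / (1 - α * r) := by positivity
  obtain ⟨F, hF, hFr, hFJ⟩ := T.exists_lintegral_integrand_le α hf.1
  have h1 := (rieszLIntegral_Lp_le hα hr (by linarith) le_rfl hF).trans_lt
    (ENNReal.mul_lt_top ENNReal.ofReal_lt_top
      (by simpa only [hFr r hr0, eLpNorm'] using hf.eLpNorm'_lt_top hr hrp))
  rw [ENNReal.rpow_lt_top_iff_of_pos (by positivity)] at h1
  have h2 := ae_lt_top ((measurable_rieszLIntegral α hF).pow_const _) h1.ne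
  filter_upwards [ae_restrict_mem measurableSet_Icc, ae_restrict_of_ae h2] with x hx hJ
  rw [ENNReal.rpow_lt_top_iff_of_pos hs] at hJ
  exact ⟨T.aestronglyMeasurable_integrand α hf.1 hx, (hFJ x hx).trans_lt hJ⟩

/-! ### Unboundedness below the critical value -/

/-- With `a = exp (-L)`, the weighted `L^(p - ε)` norm of the indicator function of an interval of
length `a` is `O (L ^ (-θ / p) * a ^ (1 / p))` uniformly in `ε`: lowering the exponent gains a factor
`exp (-L σ)` with `σ = 1 / (p - ε) - 1 / p` of order `ε`, and `ε ^ c * exp (-L ε / p ^ 2)` is at most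
a multiple of `L ^ (-c)`. -/
theorem rpow_mul_exp_neg_le {ε p θ L : ℝ} (hθ : 0 < θ) (hε : 0 < ε) (hεp : ε < p - 1)
    (hL : 0 < L) :
    ε ^ (θ / (p - ε)) * Real.exp (-L) ^ (1 / (p - ε)) ≤
      (p ^ θ * (p ^ 2 * (θ / p)) ^ (θ / p)) * (L ^ (-(θ / p)) * Real.exp (-L) ^ (1 / p)) := by
  have hp : 1 < p := by linarith
  have hp0 : 0 < p := by linarith
  have hs : 1 < p - ε := by linarith
  have hs0 : 0 < p - ε := by linarith
  set c := θ / p with hc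
  have hc0 : 0 < c := by positivity
  set σ := 1 / (p - ε) - 1 / p with hσ
  have hσ' : σ = ε / (p * (p - ε)) := by
    rw [hσ]
    field_simp
    ring
  have hσ0 : 0 ≤ σ := by
    rw [hσ']
    positivity
  have hσ1 : σ ≤ 1 := by
    have h1 : 1 / (p - ε) ≤ 1 := by
      rw [div_le_one hs0]
      exact hs.le
    have h2 : 0 < 1 / p := by positivity
    linarith
  have hσ2 : ε / p ^ 2 ≤ σ := by
    rw [hσ']
    refine div_le_div_of_nonneg_left hε.le (by positivity) ?_
    nlinarith
  have h1 : ε ^ (θ / (p - ε)) ≤ ε ^ c * p ^ θ := by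
    rw [show θ / (p - ε) = c + θ * σ by rw [hσ, hc]; ring, Real.rpow_add hε]
    refine mul_le_mul_of_nonneg_left ?_ (by positivity)
    exact (Real.rpow_le_rpow hε.le (by linarith : ε ≤ p) (by positivity)).trans
      (Real.rpow_le_rpow_of_exponent_le hp.le (by nlinarith))
  have h2 : Real.exp (-L) ^ (1 / (p - ε)) ≤
      Real.exp (-L) ^ (1 / p) * Real.exp (-(L * (ε / p ^ 2))) := by
    rw [show 1 / (p - ε) = 1 / p + σ by rw [hσ]; ring, Real.rpow_add (Real.exp_pos _)]
    refine mul_le_mul_of_nonneg_left ?_ (by positivity)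
    rw [← Real.exp_mul, Real.exp_le_exp]
    nlinarith
  have h3 : ε ^ c * Real.exp (-(L * (ε / p ^ 2))) ≤ (p ^ 2 * c) ^ c * L ^ (-c) := by
    set y := L * (ε / p ^ 2) with hy
    have hy0 : 0 < y := by positivity
    -- `y / c ≤ exp (y / c)`, raised to the power `c`, bounds `y ^ c` by a multiple of `exp y`
    have h4 : y / c ≤ Real.exp (y / c) := by
      have := Real.add_one_le_exp (y / c)
      linarith
    have h5 := Real.rpow_le_rpow (by positivity) h4 hc0.le
    rw [← Real.exp_mul, div_mul_cancel₀ _ hc0.ne'] at h5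
    have h6 : ε = p ^ 2 * c * L⁻¹ * (y / c) := by
      rw [hy]
      field_simp
    calc ε ^ c * Real.exp (-y) = (p ^ 2 * c) ^ c * L ^ (-c) * ((y / c) ^ c * Real.exp (-y)) := by
          conv_lhs => rw [h6]
          rw [Real.mul_rpow (by positivity) (by positivity),
            Real.mul_rpow (by positivity) (by positivity), Real.inv_rpow hL.le,
            Real.rpow_neg hL.le]
          ring
      _ ≤ (p ^ 2 * c) ^ c * L ^ (-c) * (Real.exp y * Real.exp (-y)) := by gcongr
      _ = _ := by rw [← Real.exp_add, add_neg_cancel, Real.exp_zero, mul_one]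
  calc _ ≤ (ε ^ c * p ^ θ) * (Real.exp (-L) ^ (1 / p) * Real.exp (-(L * (ε / p ^ 2)))) :=
        mul_le_mul h1 h2 (by positivity) (by positivity)
    _ = (ε ^ c * Real.exp (-(L * (ε / p ^ 2)))) * (p ^ θ * Real.exp (-L) ^ (1 / p)) := by ring
    _ ≤ ((p ^ 2 * c) ^ c * L ^ (-c)) * (p ^ θ * Real.exp (-L) ^ (1 / p)) := by gcongr
    _ = _ := by ring

/-- At `ε = 1 / L` the bound of `rpow_mul_exp_neg_le` is attained up to a constant. -/
theorem le_inv_rpow_mul_exp_neg {q θ L : ℝ} (hθ : 0 < θ) (hL1 : 1 ≤ L) (hq : L⁻¹ < q - 1) :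
    Real.exp (-(1 + θ)) * (L ^ (-(θ / q)) * Real.exp (-L) ^ (1 / q)) ≤
      L⁻¹ ^ (θ / (q - L⁻¹)) * Real.exp (-L) ^ (1 / (q - L⁻¹)) := by
  have hL : 0 < L := by linarith
  have hε : 0 < L⁻¹ := by positivity
  have hε1 : L⁻¹ ≤ 1 := inv_le_one_of_one_le₀ hL1
  have hs : 1 < q - L⁻¹ := by linarith
  have hq1 : 1 < q := by linarith
  have hq0 : 0 < q := by linarith
  have hs0 : 0 < q - L⁻¹ := by linarith
  set σ := 1 / (q - L⁻¹) - 1 / q with hσ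
  have hσ' : σ = L⁻¹ / (q * (q - L⁻¹)) := by
    rw [hσ, div_sub_div _ _ hs0.ne' hq0.ne']
    congr 1 <;> ring
  have hσ1 : σ ≤ L⁻¹ := by
    rw [hσ']
    exact div_le_self hε.le (by nlinarith)
  have h1 : Real.exp (-θ) * L ^ (-(θ / q)) ≤ L⁻¹ ^ (θ / (q - L⁻¹)) := by
    rw [show θ / (q - L⁻¹) = θ * σ + θ / q by rw [hσ]; ring, Real.rpow_add hε,
      Real.inv_rpow hL.le (θ / q), Real.rpow_neg hL.le]
    refine mul_le_mul_of_nonneg_right ?_ (by positivity)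
    refine le_trans ?_ (Real.rpow_le_rpow_of_exponent_ge hε hε1
      (mul_le_mul_of_nonneg_left hσ1 hθ.le))
    -- `(1 / L) ^ (1 / L)` is bounded below because `log L ≤ L`
    rw [Real.rpow_def_of_pos hε, Real.exp_le_exp, Real.log_inv]
    have h2 : Real.log L ≤ L := (Real.log_le_sub_one_of_pos hL).trans (by linarith)
    have h3 : Real.log L * L⁻¹ ≤ 1 := by
      rw [← div_eq_mul_inv, div_le_one hL]
      exact h2
    nlinarith
  have h2 : Real.exp (-1) * Real.exp (-L) ^ (1 / q) ≤ Real.exp (-L) ^ (1 / (q - L⁻¹)) := by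
    rw [show 1 / (q - L⁻¹) = σ + 1 / q by rw [hσ]; ring, Real.rpow_add (Real.exp_pos _)]
    refine mul_le_mul_of_nonneg_right ?_ (by positivity)
    rw [← Real.exp_mul, Real.exp_le_exp]
    have : L * σ ≤ 1 := by
      calc L * σ ≤ L * L⁻¹ := mul_le_mul_of_nonneg_left hσ1 hL.le
        _ = 1 := mul_inv_cancel₀ hL.ne'
    linarith
  calc _ = (Real.exp (-θ) * L ^ (-(θ / q))) * (Real.exp (-1) * Real.exp (-L) ^ (1 / q)) := by
        rw [neg_add, Real.exp_add]
        ring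
    _ ≤ _ := mul_le_mul h1 h2 (by positivity) (by positivity)

theorem eLpNorm'_indicator_Ioo {a s : ℝ} (ha : 0 < a) (ha1 : a ≤ 1) (hs : 0 < s) :
    eLpNorm' ((Ioo 0 a).indicator fun _ => (1 : ℝ)) s (volume.restrict (Icc 0 1)) =
      ENNReal.ofReal (a ^ (1 / s)) := by
  have h : ∀ t : ℝ, ‖(Ioo 0 a).indicator (fun _ => (1 : ℝ)) t‖ₑ ^ s =
      (Ioo 0 a).indicator (fun _ => (1 : ℝ≥0∞)) t := fun t => by
    by_cases ht : t ∈ Ioo 0 a <;> simp [ht, hs]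
  simp_rw [eLpNorm', h]
  rw [lintegral_indicator measurableSet_Ioo, Measure.restrict_restrict measurableSet_Ioo,
    inter_eq_self_of_subset_left (Ioo_subset_Icc_self.trans (Icc_subset_Icc_right ha1)),
    setLIntegral_one, Real.volume_Ioo, sub_zero, ENNReal.ofReal_rpow_of_pos ha]

theorem grandNorm_indicator_Ioo_le {p θ L : ℝ} (hθ : 0 < θ) (hL : 0 < L) :
    grandNorm (Icc 0 1) p θ ((Ioo 0 (Real.exp (-L))).indicator fun _ => (1 : ℝ)) ≤
      ENNReal.ofReal ((p ^ θ * (p ^ 2 * (θ / p)) ^ (θ / p)) *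
        (L ^ (-(θ / p)) * Real.exp (-L) ^ (1 / p))) := by
  refine grandNorm_le fun ε hε hεp => ?_
  rw [eLpNorm'_indicator_Ioo (Real.exp_pos _) (Real.exp_le_one_iff.2 (by linarith))
    (by linarith), ← ENNReal.ofReal_mul (by positivity)]
  exact ENNReal.ofReal_le_ofReal (rpow_mul_exp_neg_le hθ hε hεp hL)

/-- Each potential of the indicator function of `(0, a)` is at least `a ^ α / 2` on one of the two
halves `E` of `(0, a)`, by the contribution of the other half `S`. -/
theorem PotentialKind.exists_le_op_indicator (T : PotentialKind) {α a : ℝ} (hα1 : α < 1)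
    (ha : 0 < a) (ha1 : a ≤ 1) :
    ∃ E ⊆ Ioo 0 a, MeasurableSet E ∧ volume E = ENNReal.ofReal (a / 2) ∧ ∀ x ∈ E,
      IntegrableOn (T.integrand α ((Ioo 0 a).indicator fun _ => 1) x) (T.domain x) →
        a ^ α / 2 ≤ T.op α ((Ioo 0 a).indicator fun _ => 1) x := by
  have main : ∀ u v x : ℝ, v - u = a / 2 → u < v → Ioo u v ⊆ T.domain x → Ioo u v ⊆ Ioo 0 a →
      x ∉ Ioo u v → x ∈ Ioo 0 a →
      IntegrableOn (T.integrand α ((Ioo 0 a).indicator fun _ => 1) x) (T.domain x) →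
      a ^ α / 2 ≤ T.op α ((Ioo 0 a).indicator fun _ => 1) x := by
    intro u v x huv hlt hS hSa hxS hx hint
    have h0 : ∀ t ∈ T.domain x, 0 ≤ T.integrand α ((Ioo 0 a).indicator fun _ => 1) x t := by
      intro t ht
      rw [T.integrand_eq _ _ ht]
      exact div_nonneg (indicator_nonneg (fun _ _ => zero_le_one) _)
        (Real.rpow_nonneg (abs_nonneg _) _)
    have h1 : ∀ t ∈ Ioo u v, a ^ (α - 1) ≤
        T.integrand α ((Ioo 0 a).indicator fun _ => 1) x t := by
      intro t ht
      have hta := hSa ht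
      have hpos : 0 < |x - t| := by
        rw [abs_pos, sub_ne_zero]
        rintro rfl
        exact hxS ht
      have hle : |x - t| ≤ a := by
        rw [abs_le]
        constructor <;> linarith [hx.1, hx.2, hta.1, hta.2]
      rw [T.integrand_eq _ _ (hS ht), indicator_of_mem hta, one_div,
        ← Real.rpow_neg (abs_nonneg _), neg_sub]
      exact Real.rpow_le_rpow_of_nonpos hpos hle (by linarith)
    calc a ^ α / 2 = a ^ (α - 1) * volume.real (Ioo u v) := by
          rw [Real.volume_real_Ioo_of_le hlt.le, huv, Real.rpow_sub_one ha.ne']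
          field_simp
      _ ≤ ∫ t in Ioo u v, T.integrand α ((Ioo 0 a).indicator fun _ => 1) x t :=
          setIntegral_ge_of_const_le_real measurableSet_Ioo (by simp) h1 (hint.mono_set hS)
      _ ≤ _ := setIntegral_mono_set hint
          ((ae_restrict_mem (T.measurableSet_domain x)).mono h0) (LE.le.eventuallyLE hS)
  have hvol : ∀ u v : ℝ, v - u = a / 2 → volume (Ioo u v) = ENNReal.ofReal (a / 2) :=
    fun u v h => by rw [Real.volume_Ioo, h]
  have hl : Ioo 0 (a / 2) ⊆ Ioo 0 a := Ioo_subset_Ioo_right (by linarith)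
  have hr : Ioo (a / 2) a ⊆ Ioo 0 a := Ioo_subset_Ioo_left (by linarith)
  cases T with
  | I =>
    refine ⟨Ioo (a / 2) a, hr, measurableSet_Ioo, hvol _ _ (by ring), fun x hx => ?_⟩
    exact main 0 (a / 2) x (by ring) (by linarith)
      (fun t ht => ⟨ht.1, by linarith [ht.2]⟩) hl (fun h => by linarith [h.2, hx.1]) (hr hx)
  | R =>
    refine ⟨Ioo (a / 2) a, hr, measurableSet_Ioo, hvol _ _ (by ring), fun x hx => ?_⟩
    exact main 0 (a / 2) x (by ring) (by linarith)
      (fun t ht => ⟨ht.1, by linarith [ht.2, hx.1]⟩) hl (fun h => by linarith [h.2, hx.1]) (hr hx)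
  | W =>
    refine ⟨Ioo 0 (a / 2), hl, measurableSet_Ioo, hvol _ _ (by ring), fun x hx => ?_⟩
    exact main (a / 2) a x (by ring) (by linarith)
      (fun t ht => ⟨by linarith [ht.1, hx.2], by linarith [ht.2]⟩) hr
      (fun h => by linarith [h.1, hx.2]) (hl hx)

/-- For `θ₂` below the critical value the indicator functions of `(0, exp (-L))`, tested at `ε = 1 / L`,
violate every norm inequality as `L → ∞`. -/
theorem PotentialKind.not_boundedGrandLp_op (T : PotentialKind) {α p θ₁ θ₂ : ℝ} (hα : 0 < α)
    (hp : 1 < p) (hαp : α * p < 1) (hθ₁ : 0 < θ₁) (hθ₂ : 0 < θ₂)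
    (hθ : θ₂ < θ₁ / (1 - α * p)) :
    ¬ BoundedGrandLp (T.op α) p θ₁ (p / (1 - α * p)) θ₂ := by
  rintro ⟨C, hC⟩
  have hp0 : 0 < p := by linarith
  have hα1 : α < 1 := by nlinarith
  have hp' : 0 < 1 - α * p := by linarith
  set q := p / (1 - α * p) with hq
  have hq1 : 1 < q := by
    rw [hq, lt_div_iff₀ hp']
    nlinarith
  have hq0 : 0 < q := by linarith
  have hpq : α + 1 / q = 1 / p := by
    rw [hq]
    field_simp
    ring
  have hd : 0 < θ₁ / p - θ₂ / q := by
    have : θ₂ / q < θ₁ / p := by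
      rw [hq, div_div_eq_mul_div]
      rw [lt_div_iff₀ hp'] at hθ
      exact div_lt_div_of_pos_right hθ hp0
    linarith
  set M := p ^ θ₁ * (p ^ 2 * (θ₁ / p)) ^ (θ₁ / p) with hM
  have hbound : ∀ L : ℝ, 1 ≤ L → L⁻¹ < q - 1 →
      L ^ (θ₁ / p - θ₂ / q) ≤ 4 * Real.exp (1 + θ₂) * (C * M) := by
    intro L hL1 hLq
    have hL : 0 < L := by linarith
    set a := Real.exp (-L) with ha
    have ha0 : 0 < a := Real.exp_pos _
    have ha1 : a ≤ 1 := Real.exp_le_one_iff.2 (by linarith)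
    set f : ℝ → ℝ := (Ioo 0 a).indicator fun _ => 1 with hf
    have hup := grandNorm_indicator_Ioo_le (p := p) hθ₁ hL
    have hmem : MemGrandLp (Icc 0 1) p θ₁ f :=
      ⟨(measurable_const.indicator measurableSet_Ioo).aestronglyMeasurable,
        hup.trans_lt ENNReal.ofReal_lt_top⟩
    obtain ⟨E, hEa, hEm, hEv, hE⟩ := T.exists_le_op_indicator hα1 ha0 ha1
    set s := q - L⁻¹ with hs
    have hs1 : 1 < s := by linarith
    have hs0 : 0 < s := by linarith
    have hlow : ENNReal.ofReal (a ^ α / 2 * (a / 2) ^ (1 / s)) ≤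
        eLpNorm' (T.op α f) s (volume.restrict (Icc 0 1)) := by
      have hEI : E ⊆ Icc 0 1 := fun x hx => ⟨(hEa hx).1.le, (hEa hx).2.le.trans ha1⟩
      have h1 : ENNReal.ofReal (a ^ α / 2) ^ s * ENNReal.ofReal (a / 2) ≤
          ∫⁻ x in Icc 0 1, ‖T.op α f x‖ₑ ^ s := by
        rw [← hEv, ← setLIntegral_const]
        refine le_trans (lintegral_mono_ae ?_) (lintegral_mono_set hEI)
        filter_upwards [ae_restrict_mem hEm, ae_restrict_of_ae_restrict_of_subset hEI
          (T.ae_integrableOn_integrand hα hp hαp hmem)] with x hx hint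
        refine ENNReal.rpow_le_rpow ?_ hs0.le
        exact (ENNReal.ofReal_le_ofReal (hE x hx hint)).trans (Real.ofReal_le_enorm _)
      have h2 := ENNReal.rpow_le_rpow h1 (show 0 ≤ 1 / s by positivity)
      rw [ENNReal.mul_rpow_of_nonneg _ _ (by positivity), ← ENNReal.rpow_mul,
        mul_one_div_cancel hs0.ne', ENNReal.rpow_one, ENNReal.ofReal_rpow_of_pos (by positivity),
        ← ENNReal.ofReal_mul (by positivity)] at h2
      exact h2
    have hchain : ENNReal.ofReal (L⁻¹ ^ (θ₂ / s) * (a ^ α / 2 * (a / 2) ^ (1 / s))) ≤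
        ENNReal.ofReal (C * (M * (L ^ (-(θ₁ / p)) * a ^ (1 / p)))) := by
      rw [ENNReal.ofReal_mul (by positivity), ENNReal.ofReal_mul C.coe_nonneg, ENNReal.ofReal_coe_nnreal]
      exact (mul_le_mul_right hlow _).trans ((le_grandNorm (by positivity) hLq _).trans
        ((hC f hmem).2.trans (mul_le_mul_right hup _)))
    rw [ENNReal.ofReal_le_ofReal_iff (by positivity)] at hchain
    have h4 : a ^ (1 / s) / 2 ≤ (a / 2) ^ (1 / s) := by
      rw [Real.div_rpow ha0.le zero_le_two]
      refine div_le_div_of_nonneg_left (by positivity) (by positivity) ?_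
      calc (2 : ℝ) ^ (1 / s) ≤ 2 ^ (1 : ℝ) :=
            Real.rpow_le_rpow_of_exponent_le one_le_two (by rw [div_le_one hs0]; exact hs1.le)
        _ = 2 := Real.rpow_one _
    have h5 := le_inv_rpow_mul_exp_neg hθ₂ hL1 hLq
    rw [← ha, ← hs] at h5
    have h6 : Real.exp (-(1 + θ₂)) * (L ^ (-(θ₂ / q)) * a ^ (1 / p)) / 4 ≤
        C * (M * (L ^ (-(θ₁ / p)) * a ^ (1 / p))) := by
      refine le_trans ?_ hchain
      calc _ = Real.exp (-(1 + θ₂)) * (L ^ (-(θ₂ / q)) * a ^ (1 / q)) * (a ^ α / 4) := by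
            rw [← hpq, Real.rpow_add ha0]
            ring
        _ ≤ L⁻¹ ^ (θ₂ / s) * a ^ (1 / s) * (a ^ α / 4) := by gcongr
        _ = L⁻¹ ^ (θ₂ / s) * (a ^ α / 2 * (a ^ (1 / s) / 2)) := by ring
        _ ≤ _ := by gcongr
    have hap : 0 < a ^ (1 / p) := by positivity
    have h7 : Real.exp (-(1 + θ₂)) * L ^ (-(θ₂ / q)) ≤ 4 * (C * M) * L ^ (-(θ₁ / p)) := by
      refine le_of_mul_le_mul_right ?_ hap
      linarith
    calc L ^ (θ₁ / p - θ₂ / q) = Real.exp (1 + θ₂) * L ^ (θ₁ / p) *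
          (Real.exp (-(1 + θ₂)) * L ^ (-(θ₂ / q))) := by
          rw [sub_eq_add_neg, Real.rpow_add hL, Real.exp_neg]
          field_simp
      _ ≤ Real.exp (1 + θ₂) * L ^ (θ₁ / p) * (4 * (C * M) * L ^ (-(θ₁ / p))) := by gcongr
      _ = _ := by
        rw [Real.rpow_neg hL.le]
        field_simp
  have htend := tendsto_rpow_atTop hd
  obtain ⟨L, h1, h2, h3⟩ := ((htend.eventually_gt_atTop
    (4 * Real.exp (1 + θ₂) * (C * M))).and ((Filter.eventually_ge_atTop 1).and
      (tendsto_inv_atTop_zero.eventually_lt_const (by linarith : (0 : ℝ) < q - 1)))).exists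
  exact absurd (hbound L h2 h3) (not_le.2 h1)

/-! ### The critical exponent -/

theorem corollary5p1 (T : PotentialKind) (p α q θ₁ θ₂ : ℝ)
    (hp : 1 < p) (hα : 0 < α) (hαp : α < 1 / p) (hq : q = p / (1 - α * p))
    (hθ₁ : 0 < θ₁) (hθ₂ : 0 < θ₂) :
    (∀ f : ℝ → ℝ, MemGrandLp (Icc 0 1) p θ₁ f →
      ∀ᵐ x ∂(volume.restrict (Icc (0 : ℝ) 1)),
        IntegrableOn (T.integrand α f x) (T.domain x) volume) ∧
    (θ₂ < (1 + α * q) * θ₁ → ¬ BoundedGrandLp (T.op α) p θ₁ q θ₂) ∧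
    ((1 + α * q) * θ₁ ≤ θ₂ → BoundedGrandLp (T.op α) p θ₁ q θ₂) := by
  subst hq
  rw [lt_div_iff₀ (by linarith)] at hαp
  have hp' : 0 < 1 - α * p := by linarith
  have hθ : (1 + α * (p / (1 - α * p))) * θ₁ = θ₁ / (1 - α * p) := by
    field_simp
    ring
  rw [hθ]
  exact ⟨fun f hf => T.ae_integrableOn_integrand hα hp hαp hf,
    fun h => T.not_boundedGrandLp_op hα hp hαp hθ₁ hθ₂ h,
    fun h => T.boundedGrandLp_op hα hp hαp hθ₁ h⟩
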